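/- Let $\rho=\rho_{AB}$ be a state (density matrix) of a bipartite quantum system $AB$ with finite-dimensional Hilbert spaces, of dimensions $d_A$ and $d_B$. Let $n$ be a natural number and let $$R:\tau\longmapsto\sum_{i=1}^N p_i\,(U_i\otimes V_i)\,\tau\,(U_i\otimes V_i)^\dagger$$ be a coordinated local unitary randomising (COLUR) map on $A^nB^n$, where $(p_i)_{i=1}^N$ is a probability distribution and the $U_i$, $V_i$ are unitaries on $A^n$ and $B^n$. Suppose that $R$ $\epsilon$-decorrelates $\rho^{\otimes n}$: there are states $\omega_A$ of $A^n$ and $\omega_B$ of $B^n$ with $\|R(\rho^{\otimes n})-\omega_A\otimes\omega_B\|_1\le\epsilon$ (trace norm). Let $d\ge 0$ be a real number such that the output $R(\rho^{\otimes n})$ is supported on a tensor product $K_A\otimes K_B$ of subspaces of $A^n$ and $B^n$ with $\dim(K_A\otimes K_B)\le d^n$; for example $d=d_Ad_B$, which is always allowed. Let $S(\sigma)=-\operatorname{Tr}\sigma\log\sigma$ be the von Neumann entropy (logarithms to base $2$), $I(A:B)=S(\rho_A)+S(\rho_B)-S(\rho_{AB})$ the quantum mutual information of $\rho$, and $$\eta(x)=\begin{cases}-x\log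 x & \text{for } x\le \frac1e,\\ \frac1e\log e & \text{for } x\ge\frac1e,\end{cases}\qquad \eta(0)=0 .$$ Then the entropy exchange $S_e(R,\rho^{\otimes n})=S\bigl((\mathrm{id}_Z\otimes R)(|\psi\rangle\langle\psi|)\bigr)$, computed with an arbitrary finite-dimensional reference system $Z$ and an arbitrary purification $|\psi\rangle$ of $\rho^{\otimes n}$ on $ZA^nB^n$, satisfies $$S_e(R,\rho^{\otimes n})\ \ge\ n\bigl(I(A:B)-3\epsilon\log d-\eta(3\epsilon)\bigr).$$ The right-hand side is also a lower bound on the Shannon entropy $H(p)=-\sum_i p_i\log p_i$ and on $\log N$. -/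

import Mathlib

open scoped Kronecker ComplexOrder

noncomputable section

namespace QErasure

/-! Finite-dimensional quantum systems: a system with Hilbert space `ℂ^P` is given by a finite
type `P`, its operators are `Matrix P P ℂ`, and a composite system is given by a product type. -/

/-- A state (density matrix): positive semidefinite of trace one. -/
structure IsState {P : Type*} [Fintype P] (ρ : Matrix P P ℂ) : Prop where
  posSemidef : ρ.PosSemidef
  trace_eq_one : ρ.trace = 1

/-- The von Neumann entropy `S(ρ) = -Tr ρ log₂ ρ`, that is `-∑ λ log₂ λ` over the eigenvalues of
the Hermitian matrix `ρ`, with multiplicity (and `0` if `ρ` is not Hermitian). -/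
def vonNeumannEntropy {P : Type*} [Fintype P] [DecidableEq P] (ρ : Matrix P P ℂ) : ℝ :=
  if h : ρ.IsHermitian then -∑ i, h.eigenvalues i * Real.logb 2 (h.eigenvalues i) else 0

/-- The Shannon entropy `H(p) = -∑ pᵢ log₂ pᵢ`. -/
def shannonEntropy {N : ℕ} (p : Fin N → ℝ) : ℝ :=
  -∑ i, p i * Real.logb 2 (p i)

/-- The trace norm: the sum of the singular values, i.e. of the square roots of the eigenvalues of
`Mᴴ M`. For Hermitian `M` this is the sum of the absolute values of the eigenvalues. -/
def traceNorm {P : Type*} [Fintype P] [DecidableEq P] (M : Matrix P P ℂ) : ℝ :=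
  ∑ i, Real.sqrt ((Matrix.isHermitian_conjTranspose_mul_self M).eigenvalues i)

/-- Partial trace over the first factor. -/
def traceFst {P Q : Type*} [Fintype P] (M : Matrix (P × Q) (P × Q) ℂ) : Matrix Q Q ℂ :=
  fun q q' => ∑ x, M (x, q) (x, q')

/-- Partial trace over the second factor. -/
def traceSnd {P Q : Type*} [Fintype Q] (M : Matrix (P × Q) (P × Q) ℂ) : Matrix P P ℂ :=
  fun x x' => ∑ q, M (x, q) (x', q)

/-- The quantum mutual information `I(A:B) = S(ρ_A) + S(ρ_B) - S(ρ_AB)`. -/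
def mutualInformation {A B : Type*} [Fintype A] [DecidableEq A] [Fintype B] [DecidableEq B]
    (ρ : Matrix (A × B) (A × B) ℂ) : ℝ :=
  vonNeumannEntropy (traceSnd ρ) + vonNeumannEntropy (traceFst ρ) - vonNeumannEntropy ρ

/-- `ρ^{⊗ n}`, as an operator on `Aⁿ Bⁿ`, where `Aⁿ` is the system `Fin n → A`. -/
def tensorPow {A B : Type*} (ρ : Matrix (A × B) (A × B) ℂ) (n : ℕ) :
    Matrix ((Fin n → A) × (Fin n → B)) ((Fin n → A) × (Fin n → B)) ℂ :=
  fun x y => ∏ i, ρ (x.1 i, x.2 i) (y.1 i, y.2 i)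

/-- An ensemble `{pᵢ, Uᵢ ⊗ Vᵢ}`, `i = 1, …, N`, of local unitaries on the bipartite
system `A B`. -/
structure LocalUnitaryEnsemble (A B : Type*) [Fintype A] [DecidableEq A] [Fintype B]
    [DecidableEq B] where
  /-- the number of elements -/
  N : ℕ
  /-- the probabilities -/
  p : Fin N → ℝ
  p_nonneg : ∀ i, 0 ≤ p i
  p_sum : ∑ i, p i = 1
  /-- the unitaries on the first system -/
  U : Fin N → Matrix.unitaryGroup A ℂ
  /-- the unitaries on the second system -/
  V : Fin N → Matrix.unitaryGroup B ℂ

/-- The coordinated local unitary randomising (COLUR) map of an ensemble,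
`R : τ ↦ ∑ pᵢ (Uᵢ ⊗ Vᵢ) τ (Uᵢ ⊗ Vᵢ)†`. -/
def LocalUnitaryEnsemble.map {A B : Type*} [Fintype A] [DecidableEq A] [Fintype B]
    [DecidableEq B] (R : LocalUnitaryEnsemble A B) :
    Matrix (A × B) (A × B) ℂ →ₗ[ℂ] Matrix (A × B) (A × B) ℂ where
  toFun τ := ∑ i, (R.p i : ℂ) •
    (((R.U i : Matrix A A ℂ) ⊗ₖ (R.V i : Matrix B B ℂ)) * τ *
      ((R.U i : Matrix A A ℂ) ⊗ₖ (R.V i : Matrix B B ℂ)).conjTranspose)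
  map_add' σ τ := by
    simp only [Matrix.mul_add, Matrix.add_mul, smul_add, Finset.sum_add_distrib]
  map_smul' c τ := by
    simp only [Matrix.mul_smul, Matrix.smul_mul, Finset.smul_sum, RingHom.id_apply]
    exact Finset.sum_congr rfl fun i _ => smul_comm _ _ _

/-- `T` `ε`-decorrelates `ρ`: there is a product state `ω_A ⊗ ω_B` such that
`‖T(ρ) - ω_A ⊗ ω_B‖₁ ≤ ε`. -/
def Decorrelates {A B : Type*} [Fintype A] [DecidableEq A] [Fintype B] [DecidableEq B]
    (ε : ℝ) (T : Matrix (A × B) (A × B) ℂ →ₗ[ℂ] Matrix (A × B) (A × B) ℂ)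
    (ρ : Matrix (A × B) (A × B) ℂ) : Prop :=
  ∃ (ωA : Matrix A A ℂ) (ωB : Matrix B B ℂ),
    IsState ωA ∧ IsState ωB ∧ traceNorm (T ρ - ωA ⊗ₖ ωB) ≤ ε

/-- The operator `|ψ⟩⟨ψ|`. -/
def proj {P : Type*} (ψ : P → ℂ) : Matrix P P ℂ :=
  Matrix.vecMulVec ψ (star ψ)

/-- The vector `ψ` of `Z P` purifies `ρ`: `Tr_Z |ψ⟩⟨ψ| = ρ`. -/
def IsPurification {Z P : Type*} [Fintype Z] (ψ : Z × P → ℂ) (ρ : Matrix P P ℂ) : Prop :=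
  traceFst (proj ψ) = ρ

/-- `id_Z ⊗ T`: apply `T` to each of the blocks `⟨z| X |z'⟩`. -/
def idTensor {P : Type*} (Z : Type*) (T : Matrix P P ℂ →ₗ[ℂ] Matrix P P ℂ)
    (X : Matrix (Z × P) (Z × P) ℂ) : Matrix (Z × P) (Z × P) ℂ :=
  fun x y => T (fun a b => X (x.1, a) (y.1, b)) x.2 y.2

/-- The entropy exchange `S_e(T, ρ) = S((id_Z ⊗ T)(|ψ⟩⟨ψ|))` of `T`, computed with a
purification `ψ` of the input state `ρ`. -/
def entropyExchange {Z P : Type*} [Fintype Z] [DecidableEq Z] [Fintype P] [DecidableEq P]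
    (T : Matrix P P ℂ →ₗ[ℂ] Matrix P P ℂ) (ψ : Z × P → ℂ) : ℝ :=
  vonNeumannEntropy (idTensor Z T (proj ψ))

/-- `σ` is supported on a tensor product `K_A ⊗ K_B` of subspaces `K_A` of `A` and `K_B` of `B`
(the ranges of the orthogonal projections `P` and `Q`) with `dim (K_A ⊗ K_B) ≤ D`.
With `P = 1`, `Q = 1` every `σ` has this property for `D = dim A * dim B`. -/
def HasLocalSupport {A B : Type*} [Fintype A] [DecidableEq A] [Fintype B] [DecidableEq B]
    (σ : Matrix (A × B) (A × B) ℂ) (D : ℝ) : Prop :=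
  ∃ (P : Matrix A A ℂ) (Q : Matrix B B ℂ), IsStarProjection P ∧ IsStarProjection Q ∧
    (P ⊗ₖ Q) * σ = σ ∧ (P.rank : ℝ) * (Q.rank : ℝ) ≤ D

/-- `η(x) = -x log₂ x` for `x ≤ 1/e` and `η(x) = (1/e) log₂ e` for `x ≥ 1/e`. -/
def eta (x : ℝ) : ℝ :=
  if x ≤ 1 / Real.exp 1 then -x * Real.logb 2 x
  else 1 / Real.exp 1 * Real.logb 2 (Real.exp 1)

end QErasure

end

/-!
The map `R` is dilated: `φ = ∑ᵢ √pᵢ (Uᵢ ⊗ Vᵢ) ψ ⊗ |i⟩` is a pure state of reference `Z`, system and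
environment `E`, and `(id ⊗ R)(|ψ⟩⟨ψ|)` is its marginal on `Z` and the system. The two marginals of
a pure state have the same entropy, so the entropy exchange is `S(E)`, while the output
`σ = R(ρ^{⊗ n})` has the entropy of `Z E`. Subadditivity and `S(Z) = S(ρ^{⊗ n}) = n S(ρ)` give
`S(σ) ≤ n S(ρ) + S(E)` (`LocalUnitaryEnsemble.natEntropy_map_le`).

The marginals of `σ` are mixtures of unitary images of `ρ_A^{⊗ n}` and `ρ_B^{⊗ n}`, so by concavity
their entropies are at least `n S(ρ_A)` and `n S(ρ_B)`. It remains to bound the mutual information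
of `σ`. Since `σ` is `ε`-close to `ω_A ⊗ ω_B`, its marginals are `ε`-close to `ω_A` and `ω_B`, hence
`σ` is `3 ε`-close to `σ_A ⊗ σ_B`; both live on `K_A ⊗ K_B`, and Fannes' inequality there bounds
`S(σ_A ⊗ σ_B) - S(σ)` by `3 ε n log d + η(3 ε)` (`mutual_information_le`). Adding up gives the bound
on `S(E)`. Finally the diagonal of the state of `E` is `p`, whence `S(E) ≤ H(p) ≤ log N`.

All entropy inequalities come from a single fact, `natEntropy_le_diag`: measuring a state in an
orthonormal basis does not decrease its entropy. Measuring in the eigenbasis of a mixture gives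
concavity, in the product of the eigenbases of the marginals subadditivity, and in the eigenbasis
of the second state the one-sided form of Fannes' inequality. Each time only an inequality between
finite probability distributions is left. In particular no perturbation theory of eigenvalues is
needed. Entropies are handled in natural units and converted to bits at the end.
-/

namespace QErasure

open Real

/-! ### Entropy of finite probability distributions -/

section Distributions

open Finset

/-- The pointwise form of Gibbs' inequality `a log (r / a) ≤ r - a`. -/
lemma negMulLog_le_gibbs {a r : ℝ} (ha : 0 ≤ a) (hr : 0 ≤ r) (h : r = 0 → a = 0) :
    negMulLog a ≤ -a * log r + (r - a) := by
  rcases ha.eq_or_lt with rfl | ha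
  · simpa using hr
  have hr' : 0 < r := hr.lt_of_ne fun h0 => ha.ne' (h h0.symm)
  have h1 := log_le_sub_one_of_pos (div_pos hr' ha)
  rw [log_div hr'.ne' ha.ne'] at h1
  have h2 := mul_le_mul_of_nonneg_left h1 ha.le
  have h3 : a * (r / a - 1) = r - a := by field_simp
  rw [negMulLog]
  linarith

lemma negMulLog_add_le {a b : ℝ} (ha : 0 ≤ a) (hb : 0 ≤ b) :
    negMulLog (a + b) ≤ negMulLog a + negMulLog b := by
  rcases ha.eq_or_lt with rfl | ha
  · simp
  rcases hb.eq_or_lt with rfl | hb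
  · simp
  have h1 := mul_le_mul_of_nonneg_left (log_le_log ha (by linarith : a ≤ a + b)) ha.le
  have h2 := mul_le_mul_of_nonneg_left (log_le_log hb (by linarith : b ≤ a + b)) hb.le
  simp only [negMulLog]
  linarith

/-- `x ↦ negMulLog x + x` is monotone on `[0, 1]`. -/
lemma negMulLog_le_add_sub {q p : ℝ} (hq : 0 ≤ q) (hqp : q ≤ p) (hp : p ≤ 1) :
    negMulLog q ≤ negMulLog p + (p - q) := by
  have h1 := negMulLog_le_gibbs hq (hq.trans hqp) (fun h => by linarith)
  have h2 := mul_le_mul_of_nonneg_right hqp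
    (neg_nonneg.2 (log_nonpos (hq.trans hqp) hp))
  simp only [negMulLog] at *
  linarith

lemma negMulLog_le_of_le_inv_exp {u v : ℝ} (hu : 0 ≤ u) (huv : u ≤ v) (hv : v ≤ 1 / exp 1) :
    negMulLog u ≤ negMulLog v := by
  rcases (hu.trans huv).eq_or_lt with h0 | hv0
  · rw [le_antisymm (by linarith) hu, h0]
  have h1 := negMulLog_le_gibbs hu hv0.le (fun h => by linarith)
  have h2 : log v ≤ -1 := by
    rw [log_le_iff_le_exp hv0, exp_neg]; simpa using hv
  simp only [negMulLog] at *
  nlinarith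

/-- Averaging a vector by a doubly stochastic matrix increases its entropy. -/
lemma sum_negMulLog_le_of_doublyStochastic {ι κ : Type*} [Fintype ι] [Fintype κ] {w : κ → ι → ℝ}
    (hw : ∀ k j, 0 ≤ w k j) (h1 : ∀ k, ∑ j, w k j = 1) (h2 : ∀ j, ∑ k, w k j = 1)
    {l : ι → ℝ} (hl : ∀ j, 0 ≤ l j) :
    ∑ j, negMulLog (l j) ≤ ∑ k, negMulLog (∑ j, w k j * l j) := by
  calc ∑ j, negMulLog (l j) = ∑ j, ∑ k, w k j * negMulLog (l j) := by
        simp [← Finset.sum_mul, h2]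
    _ = ∑ k, ∑ j, w k j * negMulLog (l j) := Finset.sum_comm
    _ ≤ _ := Finset.sum_le_sum fun k _ =>
        concaveOn_negMulLog.le_map_sum (fun j _ => hw k j) (h1 k) fun j _ => hl j

lemma sum_negMulLog_le_add_marginals {ι κ : Type*} [Fintype ι] [Fintype κ] {p : ι × κ → ℝ}
    (hp : ∀ x, 0 ≤ p x) (h1 : ∑ x, p x = 1) :
    ∑ x, negMulLog (p x) ≤
      ∑ i, negMulLog (∑ k, p (i, k)) + ∑ k, negMulLog (∑ i, p (i, k)) := by
  set a : ι → ℝ := fun i => ∑ k, p (i, k)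
  set b : κ → ℝ := fun k => ∑ i, p (i, k)
  have ha : ∀ i k, p (i, k) ≤ a i := fun i k =>
    Finset.single_le_sum (f := fun k => p (i, k)) (fun k _ => hp _) (Finset.mem_univ k)
  have hb : ∀ i k, p (i, k) ≤ b k := fun i k =>
    Finset.single_le_sum (f := fun i => p (i, k)) (fun k _ => hp _) (Finset.mem_univ i)
  have hsa : ∑ i, a i = 1 := by rw [← h1, Fintype.sum_prod_type]
  have hsb : ∑ k, b k = 1 := by rw [← h1, Fintype.sum_prod_type_right]
  have key : ∀ i k, negMulLog (p (i, k)) ≤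
      -p (i, k) * log (a i) + -p (i, k) * log (b k) + (a i * b k - p (i, k)) := by
    intro i k
    have h0 := hp (i, k)
    rcases h0.eq_or_lt with h | h
    · rw [← h]; simpa using mul_nonneg (h0.trans (ha i k)) (h0.trans (hb i k))
    have ha' := h.trans_le (ha i k)
    have hb' := h.trans_le (hb i k)
    have := negMulLog_le_gibbs h0 (mul_pos ha' hb').le (fun h' => absurd h' (mul_pos ha' hb').ne')
    rw [log_mul ha'.ne' hb'.ne'] at this
    linarith
  calc ∑ x, negMulLog (p x) = ∑ i, ∑ k, negMulLog (p (i, k)) := Fintype.sum_prod_type _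
    _ ≤ ∑ i, ∑ k, (-p (i, k) * log (a i) + -p (i, k) * log (b k) + (a i * b k - p (i, k))) :=
        Finset.sum_le_sum fun i _ => Finset.sum_le_sum fun k _ => key i k
    _ = ∑ i, negMulLog (a i) + ∑ k, negMulLog (b k) := by
        simp only [Finset.sum_add_distrib, Finset.sum_sub_distrib]
        rw [Finset.sum_comm (f := fun i k => -p (i, k) * log (b k))]
        simp only [← Finset.sum_mul, ← Finset.mul_sum, Finset.sum_neg_distrib, hsb, mul_one, hsa]
        have : ∑ i, ∑ k, p (i, k) = 1 := hsa
        rw [this]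
        simp [negMulLog, a, b]

/-- Entropy bound for a vector of total mass `t` on a finite set of `#s` points. -/
lemma sum_negMulLog_le_card {ι : Type*} (s : Finset ι) {p : ι → ℝ} (hp : ∀ i ∈ s, 0 ≤ p i) :
    ∑ i ∈ s, negMulLog (p i) ≤ (∑ i ∈ s, p i) * log #s + negMulLog (∑ i ∈ s, p i) := by
  set t := ∑ i ∈ s, p i with ht
  have ht0 : 0 ≤ t := Finset.sum_nonneg hp
  rcases s.eq_empty_or_nonempty with rfl | hs
  · simp [ht]
  have hm : (0 : ℝ) < #s := by exact_mod_cast hs.card_pos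
  rcases ht0.eq_or_lt with h0 | h0
  · have : ∀ i ∈ s, p i = 0 := (Finset.sum_eq_zero_iff_of_nonneg hp).1 h0.symm
    rw [← h0, Finset.sum_congr rfl fun i hi => by rw [this i hi]]
    simp
  have hr : 0 < t / #s := by positivity
  calc ∑ i ∈ s, negMulLog (p i) ≤ ∑ i ∈ s, (-p i * log (t / #s) + (t / #s - p i)) :=
        Finset.sum_le_sum fun i hi =>
          negMulLog_le_gibbs (hp i hi) hr.le (fun h => absurd h hr.ne')
    _ = t * log #s + negMulLog t := by
        rw [Finset.sum_add_distrib, Finset.sum_sub_distrib, ← Finset.sum_mul,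
          Finset.sum_neg_distrib, ← ht, log_div h0.ne' hm.ne', negMulLog]
        simp only [Finset.sum_const, nsmul_eq_mul]
        field_simp
        ring

/-- `η` in natural units: `-x log x` up to its maximum `1/e`, and constant from there on. -/
noncomputable def etaNat (x : ℝ) : ℝ :=
  if x ≤ 1 / exp 1 then negMulLog x else 1 / exp 1

lemma eta_eq_etaNat_div (x : ℝ) : eta x = etaNat x / log 2 := by
  unfold eta etaNat
  split_ifs
  · simp only [negMulLog, logb]; ring
  · simp [logb, div_eq_mul_inv]

lemma etaNat_nonneg {x : ℝ} (hx : 0 ≤ x) : 0 ≤ etaNat x := by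
  unfold etaNat
  split_ifs with h
  · refine negMulLog_nonneg hx (h.trans ?_)
    rw [div_le_one (exp_pos 1)]
    exact one_le_exp zero_le_one
  · positivity

/-- The scalar inequality behind Fannes' estimate: moving mass `t` on `r` points changes the entropy
by at most `t log m + negMulLog t + t` with `4 m ≤ r²`, and this absorbs `log m` into `2 t log r`. -/
lemma negMulLog_add_sub_le_etaNat {t Δ : ℝ} (ht : 0 < t) (h : 2 * t ≤ Δ) :
    negMulLog t + t - t * log 4 ≤ etaNat Δ := by
  unfold etaNat
  split_ifs with hΔ
  · have h2t := negMulLog_le_of_le_inv_exp (by positivity) h hΔ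
    have hlog : log (2 * t) ≤ -1 := by
      rw [log_le_iff_le_exp (by positivity), exp_neg]; simpa using h.trans hΔ
    have h4 : log 4 = 2 * log 2 := by
      rw [show (4 : ℝ) = 2 ^ 2 by norm_num, log_pow]; norm_num
    refine le_trans ?_ h2t
    rw [log_mul two_ne_zero ht.ne'] at hlog
    rw [negMulLog, negMulLog, log_mul two_ne_zero ht.ne', h4]
    nlinarith [log_pos one_lt_two]
  · have h1 := negMulLog_le_gibbs (r := 1 / 4) ht.le (by norm_num) (by norm_num)
    rw [one_div, log_inv] at h1
    have h2 : (4 : ℝ)⁻¹ ≤ 1 / exp 1 := by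
      rw [inv_eq_one_div]
      exact one_div_le_one_div_of_le (exp_pos 1) (by linarith [exp_one_lt_d9])
    linarith

/-- Fannes' continuity estimate for probability vectors. -/
lemma sum_negMulLog_sub_le {ι : Type*} [Fintype ι] {p q : ι → ℝ} (hp : ∀ i, 0 ≤ p i)
    (hq : ∀ i, 0 ≤ q i) (hp1 : ∑ i, p i = 1) (hq1 : ∑ i, q i = 1) {Δ : ℝ}
    (h : ∑ i, |q i - p i| ≤ Δ) :
    ∑ i, negMulLog (q i) - ∑ i, negMulLog (p i) ≤ Δ * log (Fintype.card ι) + etaNat Δ := by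
  classical
  set s : Finset ι := Finset.univ.filter fun i => p i < q i with hs
  set t := ∑ i ∈ s, (q i - p i) with ht
  have hple : ∀ i, p i ≤ 1 := fun i => hp1 ▸
    Finset.single_le_sum (fun i _ => hp i) (Finset.mem_univ i)
  have hmem : ∀ i, i ∈ s ↔ p i < q i := fun i => by simp [hs]
  have hcompl : ∑ i ∈ sᶜ, (p i - q i) = t := by
    have := Finset.sum_add_sum_compl s fun i => q i - p i
    rw [Finset.sum_sub_distrib q p (s := Finset.univ), hp1, hq1, ← ht] at this
    rw [← neg_inj, ← Finset.sum_neg_distrib]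
    simp only [neg_sub]
    linarith
  have ht2 : 2 * t ≤ Δ := by
    refine le_trans (le_of_eq ?_) h
    rw [← Finset.sum_add_sum_compl s, two_mul]
    congr 1
    · exact Finset.sum_congr rfl fun i hi =>
        (abs_of_pos (sub_pos.2 ((hmem i).1 hi))).symm
    · rw [← hcompl]
      refine Finset.sum_congr rfl fun i hi => ?_
      rw [Finset.mem_compl, hmem, not_lt] at hi
      rw [abs_of_nonpos (by linarith), neg_sub]
  have hΔ : 0 ≤ Δ := (Finset.sum_nonneg fun i _ => abs_nonneg _).trans h
  have hdiff : ∑ i, negMulLog (q i) - ∑ i, negMulLog (p i) ≤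
      ∑ i ∈ s, negMulLog (q i - p i) + t := by
    rw [← Finset.sum_sub_distrib, ← Finset.sum_add_sum_compl s, ← hcompl]
    refine add_le_add (Finset.sum_le_sum fun i hi => ?_) (Finset.sum_le_sum fun i hi => ?_)
    · have := negMulLog_add_le (hp i) (sub_pos.2 ((hmem i).1 hi)).le
      rw [add_sub_cancel] at this
      linarith
    · rw [Finset.mem_compl, hmem, not_lt] at hi
      linarith [negMulLog_le_add_sub (hq i) hi (hple i)]
  have hcard0 : 0 ≤ log (Fintype.card ι) := log_natCast_nonneg _
  rcases s.eq_empty_or_nonempty with h0 | hne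
  · have : t = 0 := by rw [ht, h0, Finset.sum_empty]
    rw [h0, Finset.sum_empty, this] at hdiff
    linarith [mul_nonneg hΔ hcard0, etaNat_nonneg hΔ]
  have htpos : 0 < t := Finset.sum_pos (fun i hi => sub_pos.2 ((hmem i).1 hi)) hne
  -- Not every weight can increase, so the increase lives on at most `card ι - 1` points.
  have hcne : sᶜ.Nonempty := Finset.nonempty_of_sum_ne_zero (hcompl ▸ htpos.ne')
  have hm : 1 ≤ #s := hne.card_pos
  have hm' : #s + 1 ≤ Fintype.card ι := by
    have := hcne.card_pos
    rw [Finset.card_compl] at this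
    omega
  have hmR : (1 : ℝ) ≤ #s := by exact_mod_cast hm
  have hmR' : (#s : ℝ) + 1 ≤ Fintype.card ι := by exact_mod_cast hm'
  have hlog : log #s + log 4 ≤ 2 * log (Fintype.card ι) := by
    rw [← log_mul (by positivity) (by norm_num)]
    have : 2 * log (Fintype.card ι : ℝ) = log ((Fintype.card ι : ℝ) ^ 2) := by
      rw [log_pow]; norm_num
    rw [this]
    exact log_le_log (by positivity) (by nlinarith [sq_nonneg ((#s : ℝ) - 1)])
  have h1 := sum_negMulLog_le_card s (p := fun i => q i - p i)
    fun i hi => (sub_pos.2 ((hmem i).1 hi)).le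
  have h2 := negMulLog_add_sub_le_etaNat htpos ht2
  have h3 := mul_le_mul_of_nonneg_left hlog htpos.le
  have h4 := mul_le_mul_of_nonneg_right ht2 hcard0
  simp only [← ht] at h1
  linarith

end Distributions

open Matrix

/-! ### Partial traces -/

section PartialTrace

lemma traceFst_eq_traceSnd {P Q : Type*} [Fintype P] (M : Matrix (P × Q) (P × Q) ℂ) :
    traceFst M = traceSnd (M.submatrix Prod.swap Prod.swap) := rfl

lemma traceSnd_kronecker {P Q : Type*} [Fintype Q] (X : Matrix P P ℂ) (Y : Matrix Q Q ℂ) :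
    traceSnd (X ⊗ₖ Y) = Y.trace • X := by
  ext a b
  simp [traceSnd, trace, ← Finset.mul_sum, mul_comm]

lemma traceFst_kronecker {P Q : Type*} [Fintype P] (X : Matrix P P ℂ) (Y : Matrix Q Q ℂ) :
    traceFst (X ⊗ₖ Y) = X.trace • Y := by
  ext a b
  simp [traceFst, trace, ← Finset.sum_mul]

lemma posSemidef_traceSnd {P Q : Type*} [Fintype Q] {M : Matrix (P × Q) (P × Q) ℂ}
    (hM : M.PosSemidef) : (traceSnd M).PosSemidef := by
  have : traceSnd M = ∑ q, M.submatrix (fun x => (x, q)) (fun x => (x, q)) := by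
    ext a b; simp [traceSnd, Matrix.sum_apply]
  rw [this]
  exact posSemidef_sum _ fun q _ => hM.submatrix _

lemma posSemidef_traceFst {P Q : Type*} [Fintype P] {M : Matrix (P × Q) (P × Q) ℂ}
    (hM : M.PosSemidef) : (traceFst M).PosSemidef :=
  posSemidef_traceSnd (hM.submatrix Prod.swap)

lemma kronecker_isometry {m n k l : Type*} [Fintype m] [Fintype n] [DecidableEq k]
    [DecidableEq l] {X : Matrix m k ℂ} {Y : Matrix n l ℂ} (hX : Xᴴ * X = 1) (hY : Yᴴ * Y = 1) :
    (X ⊗ₖ Y)ᴴ * (X ⊗ₖ Y) = 1 := by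
  rw [conjTranspose_kronecker, ← mul_kronecker_mul, hX, hY, one_kronecker_one]

variable {P Q P' Q' : Type*} [Fintype P] [Fintype Q] [Fintype P'] [Fintype Q']

lemma trace_traceSnd (M : Matrix (P × Q) (P × Q) ℂ) : (traceSnd M).trace = M.trace := by
  simp [trace, traceSnd, Fintype.sum_prod_type]

lemma trace_traceFst (M : Matrix (P × Q) (P × Q) ℂ) : (traceFst M).trace = M.trace := by
  simp [trace, traceFst, Fintype.sum_prod_type_right]

/-- The partial trace is dual to tensoring with the identity. -/
lemma trace_traceSnd_mul [DecidableEq Q] (M : Matrix (P × Q) (P × Q) ℂ) (X : Matrix P P ℂ) :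
    (traceSnd M * X).trace = (M * (X ⊗ₖ (1 : Matrix Q Q ℂ))).trace := by
  simp only [trace, diag_apply, mul_apply, traceSnd, Fintype.sum_prod_type, kroneckerMap_apply,
    one_apply, mul_ite, mul_one, mul_zero, Finset.sum_ite_eq', Finset.mem_univ, if_true,
    Finset.sum_mul]
  exact Finset.sum_congr rfl fun x _ => Finset.sum_comm

/-- Partial traces turn conjugation by `X ⊗ Y`, with `Y` an isometry, into conjugation by `X`. -/
lemma traceSnd_conj_kronecker [DecidableEq Q] (X : Matrix P' P ℂ) {Y : Matrix Q' Q ℂ}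
    (hY : Yᴴ * Y = 1) (M : Matrix (P × Q) (P × Q) ℂ) :
    traceSnd ((X ⊗ₖ Y) * M * (X ⊗ₖ Y)ᴴ) = X * traceSnd M * Xᴴ := by
  refine Matrix.ext_iff_trace_mul_right.2 fun Z => ?_
  classical
  have h : (X ⊗ₖ Y)ᴴ * (Z ⊗ₖ (1 : Matrix Q' Q' ℂ)) * (X ⊗ₖ Y) =
      (Xᴴ * Z * X) ⊗ₖ (1 : Matrix Q Q ℂ) := by
    rw [conjTranspose_kronecker, ← mul_kronecker_mul, ← mul_kronecker_mul, Matrix.mul_one, hY]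
  calc (traceSnd ((X ⊗ₖ Y) * M * (X ⊗ₖ Y)ᴴ) * Z).trace
      = ((X ⊗ₖ Y) * (M * ((X ⊗ₖ Y)ᴴ * (Z ⊗ₖ (1 : Matrix Q' Q' ℂ))))).trace := by
        rw [trace_traceSnd_mul]; simp only [Matrix.mul_assoc]
    _ = (M * ((X ⊗ₖ Y)ᴴ * (Z ⊗ₖ (1 : Matrix Q' Q' ℂ)) * (X ⊗ₖ Y))).trace := by
        rw [trace_mul_comm]; simp only [Matrix.mul_assoc]
    _ = (traceSnd M * (Xᴴ * Z * X)).trace := by rw [h, ← trace_traceSnd_mul]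
    _ = (X * traceSnd M * Xᴴ * Z).trace := by
        rw [← Matrix.mul_assoc, trace_mul_comm _ X]; simp only [Matrix.mul_assoc]

lemma traceFst_conj_kronecker [DecidableEq P] {X : Matrix P' P ℂ} (Y : Matrix Q' Q ℂ)
    (hX : Xᴴ * X = 1) (M : Matrix (P × Q) (P × Q) ℂ) :
    traceFst ((X ⊗ₖ Y) * M * (X ⊗ₖ Y)ᴴ) = Y * traceFst M * Yᴴ := by
  rw [traceFst_eq_traceSnd, traceFst_eq_traceSnd, ← traceSnd_conj_kronecker Y hX]
  congr 1
  ext ⟨a, b⟩ ⟨c, e⟩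
  simp only [submatrix_apply, mul_apply, Prod.swap, conjTranspose_apply, kroneckerMap_apply]
  refine ((Equiv.prodComm Q P).sum_comp _).symm.trans (Finset.sum_congr rfl fun i _ => ?_)
  rw [← (Equiv.prodComm Q P).sum_comp]
  simp only [Equiv.prodComm_apply, Prod.fst_swap, Prod.snd_swap]
  rw [mul_comm (X e _), Finset.sum_congr rfl fun j _ => by rw [mul_comm (X b _)]]
  rfl

/-! ### States -/

lemma IsState.traceSnd {ρ : Matrix (P × Q) (P × Q) ℂ} (h : IsState ρ) : IsState (traceSnd ρ) :=
  ⟨posSemidef_traceSnd h.1, (trace_traceSnd ρ).trans h.2⟩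

lemma IsState.traceFst {ρ : Matrix (P × Q) (P × Q) ℂ} (h : IsState ρ) : IsState (traceFst ρ) :=
  ⟨posSemidef_traceFst h.1, (trace_traceFst ρ).trans h.2⟩

lemma IsState.kronecker {ρ : Matrix P P ℂ} {σ : Matrix Q Q ℂ} (hρ : IsState ρ) (hσ : IsState σ) :
    IsState (ρ ⊗ₖ σ) :=
  ⟨hρ.1.kronecker hσ.1, by rw [trace_kronecker, hρ.2, hσ.2, mul_one]⟩

lemma IsState.conj [DecidableEq P] {ρ : Matrix P P ℂ} (hρ : IsState ρ) {W : Matrix Q P ℂ}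
    (hW : Wᴴ * W = 1) :
    IsState (W * ρ * Wᴴ) :=
  ⟨hρ.1.mul_mul_conjTranspose_same W, by
    rw [trace_mul_comm, ← Matrix.mul_assoc, hW, Matrix.one_mul, hρ.2]⟩

lemma IsState.submatrix_equiv {ρ : Matrix P P ℂ} (hρ : IsState ρ) (e : Q ≃ P) :
    IsState (ρ.submatrix e e) :=
  ⟨hρ.1.submatrix e, by
    rw [← hρ.2]; exact e.sum_comp fun i => ρ i i⟩

lemma IsState.re_diag_nonneg {ρ : Matrix P P ℂ} (hρ : IsState ρ) (i : P) : 0 ≤ (ρ i i).re :=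
  (Complex.nonneg_iff.1 hρ.1.diag_nonneg).1

lemma IsState.sum_re_diag {ρ : Matrix P P ℂ} (hρ : IsState ρ) : ∑ i, (ρ i i).re = 1 := by
  have := congrArg Complex.re hρ.2
  simpa [trace] using this

end PartialTrace

/-! ### Von Neumann entropy -/

section Entropy

variable {P Q : Type*} [Fintype P] [DecidableEq P] [Fintype Q] [DecidableEq Q]

/-- The von Neumann entropy in natural units, `∑ -λ log λ` over the roots `λ` of the characteristic
polynomial, with multiplicity. Being a function of the characteristic polynomial, it is manifestly
invariant under similarity, transposition and relabelling. -/
noncomputable def natEntropy (M : Matrix P P ℂ) : ℝ :=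
  (M.charpoly.roots.map fun z => negMulLog z.re).sum

lemma vonNeumannEntropy_eq {M : Matrix P P ℂ} (hM : M.IsHermitian) :
    vonNeumannEntropy M = natEntropy M / log 2 := by
  have h : natEntropy M = ∑ i, negMulLog (hM.eigenvalues i) := by
    rw [natEntropy, hM.roots_charpoly_eq_eigenvalues, Multiset.map_map]
    rfl
  rw [vonNeumannEntropy, dif_pos hM, h, ← Finset.sum_neg_distrib, Finset.sum_div]
  refine Finset.sum_congr rfl fun i _ => ?_
  simp only [negMulLog, logb]
  ring

/-- The nonzero spectra of `A B` and `B A` agree, and the eigenvalue zero does not contribute. -/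
lemma natEntropy_mul_comm (A : Matrix P Q ℂ) (B : Matrix Q P ℂ) :
    natEntropy (A * B) = natEntropy (B * A) := by
  have h := congrArg (fun p : Polynomial ℂ => (p.roots.map fun z => negMulLog z.re).sum)
    (charpoly_mul_comm' A B)
  have hne : ∀ (k : ℕ) {p : Polynomial ℂ}, p.Monic → Polynomial.X ^ k * p ≠ 0 := fun k p hp =>
    ((Polynomial.monic_X_pow k).mul hp).ne_zero
  simpa [natEntropy, Multiset.sum_nsmul, Polynomial.roots_mul (hne _ (charpoly_monic _)),
    Multiset.map_nsmul] using h

lemma natEntropy_transpose (M : Matrix P P ℂ) : natEntropy Mᵀ = natEntropy M := by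
  rw [natEntropy, charpoly_transpose, natEntropy]

lemma natEntropy_submatrix_equiv (M : Matrix P P ℂ) (e : Q ≃ P) :
    natEntropy (M.submatrix e e) = natEntropy M := by
  rw [natEntropy, natEntropy, ← charpoly_reindex e.symm M]
  rfl

lemma roots_charpoly_diagonal (d : P → ℝ) :
    (diagonal fun i => (d i : ℂ)).charpoly.roots = Finset.univ.val.map fun i => (d i : ℂ) := by
  have h : ∏ i, (Polynomial.X - Polynomial.C (d i : ℂ)) =
      ((Finset.univ.val.map fun i => (d i : ℂ)).map
        fun a => Polynomial.X - Polynomial.C a).prod := by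
    rw [Multiset.map_map]
    rfl
  rw [charpoly_diagonal, h, Polynomial.roots_multiset_prod_X_sub_C]

lemma natEntropy_diagonal (d : P → ℝ) :
    natEntropy (diagonal fun i => (d i : ℂ)) = ∑ i, negMulLog (d i) := by
  rw [natEntropy, roots_charpoly_diagonal, Multiset.map_map]
  rfl

/-- Conjugation by an isometry preserves the entropy. -/
lemma natEntropy_conj {W : Matrix Q P ℂ} (hW : Wᴴ * W = 1) (M : Matrix P P ℂ) :
    natEntropy (W * M * Wᴴ) = natEntropy M := by
  rw [natEntropy_mul_comm, ← Matrix.mul_assoc, hW, Matrix.one_mul]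

lemma exists_spectral_decomposition {M : Matrix P P ℂ} (hM : M.IsHermitian) :
    ∃ (U : Matrix P P ℂ) (d : P → ℝ), Uᴴ * U = 1 ∧ U * Uᴴ = 1 ∧
      M = U * diagonal (fun i => (d i : ℂ)) * Uᴴ :=
  ⟨hM.eigenvectorUnitary, hM.eigenvalues, Unitary.coe_star_mul_self _,
    Unitary.coe_mul_star_self _, hM.spectral_theorem⟩

/-- The spectral decomposition of a state: its eigenvalues form a probability distribution. -/
lemma IsState.exists_spectral_decomposition {ρ : Matrix P P ℂ} (hρ : IsState ρ) :
    ∃ (U : Matrix P P ℂ) (d : P → ℝ), Uᴴ * U = 1 ∧ U * Uᴴ = 1 ∧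
      Uᴴ * ρ * U = diagonal (fun i => (d i : ℂ)) ∧ ρ = U * diagonal (fun i => (d i : ℂ)) * Uᴴ ∧
      (∀ i, 0 ≤ d i) ∧ ∑ i, d i = 1 ∧ natEntropy ρ = ∑ i, negMulLog (d i) := by
  obtain ⟨U, d, h1, h2, h3⟩ := QErasure.exists_spectral_decomposition hρ.1.isHermitian
  have h4 : Uᴴ * ρ * U = diagonal (fun i => (d i : ℂ)) := by
    rw [h3, show Uᴴ * (U * diagonal (fun i => (d i : ℂ)) * Uᴴ) * U =
      (Uᴴ * U) * diagonal (fun i => (d i : ℂ)) * (Uᴴ * U) by simp only [Matrix.mul_assoc], h1,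
      Matrix.one_mul, Matrix.mul_one]
  have h5 : IsState (diagonal fun i => (d i : ℂ)) := by
    have := hρ.conj (W := Uᴴ) (by rwa [conjTranspose_conjTranspose])
    rwa [conjTranspose_conjTranspose, h4] at this
  refine ⟨U, d, h1, h2, h4, h3, fun i => by simpa using h5.re_diag_nonneg i,
    by simpa using h5.sum_re_diag, ?_⟩
  rw [← natEntropy_diagonal, ← natEntropy_conj h1 (diagonal _), ← h3]

lemma natEntropy_nonneg {ρ : Matrix P P ℂ} (hρ : IsState ρ) : 0 ≤ natEntropy ρ := by
  obtain ⟨U, d, -, -, -, -, hd, hd1, hS⟩ := hρ.exists_spectral_decomposition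
  rw [hS]
  exact Finset.sum_nonneg fun i _ => negMulLog_nonneg (hd i)
    (hd1 ▸ Finset.single_le_sum (fun i _ => hd i) (Finset.mem_univ i))

/-- A measurement in an orthonormal basis does not decrease the entropy: the diagonal of a state
is the average of its spectrum by the doubly stochastic matrix `|U i j|²`. -/
lemma natEntropy_le_diag {ρ : Matrix P P ℂ} (hρ : IsState ρ) :
    natEntropy ρ ≤ ∑ i, negMulLog (ρ i i).re := by
  obtain ⟨U, d, h1, h2, -, h4, hd, -, hS⟩ := hρ.exists_spectral_decomposition
  have hsq : ∀ z : ℂ, z * star z = (Complex.normSq z : ℂ) := fun z => Complex.mul_conj z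
  have hrow : ∀ k, ∑ j, Complex.normSq (U k j) = 1 := fun k => by
    have := congrFun₂ h2 k k
    simp only [mul_apply, conjTranspose_apply, hsq, one_apply_eq] at this
    exact_mod_cast this
  have hcol : ∀ j, ∑ k, Complex.normSq (U k j) = 1 := fun j => by
    have := congrFun₂ h1 j j
    simp only [mul_apply, conjTranspose_apply, one_apply_eq, mul_comm (star _), hsq] at this
    exact_mod_cast this
  have hdiag : ∀ k, (ρ k k).re = ∑ j, Complex.normSq (U k j) * d j := fun k => by
    have : ρ k k = ((∑ j, Complex.normSq (U k j) * d j : ℝ) : ℂ) := by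
      rw [h4, mul_apply]
      push_cast
      refine Finset.sum_congr rfl fun j _ => ?_
      rw [mul_diagonal, conjTranspose_apply, ← hsq]
      ring
    rw [this, Complex.ofReal_re]
  rw [hS]
  simp only [hdiag]
  exact sum_negMulLog_le_of_doublyStochastic (fun k j => Complex.normSq_nonneg _) hrow hcol hd

/-- Concavity of the entropy. -/
lemma sum_mul_natEntropy_le {ι : Type*} [Fintype ι] {p : ι → ℝ} (hp : ∀ i, 0 ≤ p i)
    (hp1 : ∑ i, p i = 1) {σ : ι → Matrix P P ℂ} (hσ : ∀ i, IsState (σ i))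
    (hmix : IsState (∑ i, (p i : ℂ) • σ i)) :
    ∑ i, p i * natEntropy (σ i) ≤ natEntropy (∑ i, (p i : ℂ) • σ i) := by
  obtain ⟨U, d, h1, h2, h3, -, hd, -, hS⟩ := hmix.exists_spectral_decomposition
  have hst : ∀ i, IsState (Uᴴ * σ i * U) := fun i => by
    have := (hσ i).conj (W := Uᴴ) (by rwa [conjTranspose_conjTranspose])
    rwa [conjTranspose_conjTranspose] at this
  have hent : ∀ i, natEntropy (σ i) = natEntropy (Uᴴ * σ i * U) := fun i => by
    have := natEntropy_conj (W := Uᴴ) (by rwa [conjTranspose_conjTranspose]) (σ i)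
    rw [conjTranspose_conjTranspose] at this
    exact this.symm
  have hdk : ∀ k, d k = ∑ i, p i * ((Uᴴ * σ i * U) k k).re := fun k => by
    have := congrArg Complex.re (congrFun₂ h3 k k)
    simpa [Matrix.mul_sum, Matrix.sum_mul, Matrix.sum_apply] using this.symm
  calc ∑ i, p i * natEntropy (σ i)
      ≤ ∑ i, p i * ∑ k, negMulLog ((Uᴴ * σ i * U) k k).re :=
        Finset.sum_le_sum fun i _ => mul_le_mul_of_nonneg_left
          (hent i ▸ natEntropy_le_diag (hst i)) (hp i)
    _ = ∑ k, ∑ i, p i * negMulLog ((Uᴴ * σ i * U) k k).re := by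
        simp only [Finset.mul_sum]; exact Finset.sum_comm
    _ ≤ ∑ k, negMulLog (d k) := Finset.sum_le_sum fun k _ => by
        rw [hdk]
        exact concaveOn_negMulLog.le_map_sum (fun i _ => hp i) hp1
          fun i _ => (hst i).re_diag_nonneg k
    _ = _ := hS.symm

/-- Subadditivity of the entropy. The state is measured in the product of the eigenbases of its
marginals, which reduces the claim to a joint probability distribution. -/
lemma natEntropy_le_add_marginals {ρ : Matrix (P × Q) (P × Q) ℂ} (hρ : IsState ρ) :
    natEntropy ρ ≤ natEntropy (traceSnd ρ) + natEntropy (traceFst ρ) := by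
  obtain ⟨U, d, hU, hU', hd, -, -, -, hSA⟩ := hρ.traceSnd.exists_spectral_decomposition
  obtain ⟨V, e, hV, hV', he, -, -, -, hSB⟩ := hρ.traceFst.exists_spectral_decomposition
  have hU2 : Uᴴᴴ * Uᴴ = 1 := by rwa [conjTranspose_conjTranspose]
  have hV2 : Vᴴᴴ * Vᴴ = 1 := by rwa [conjTranspose_conjTranspose]
  have hW := kronecker_isometry hU2 hV2
  set M := (Uᴴ ⊗ₖ Vᴴ) * ρ * (Uᴴ ⊗ₖ Vᴴ)ᴴ with hM
  have hMst : IsState M := hρ.conj hW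
  have hA : traceSnd M = diagonal fun i => (d i : ℂ) := by
    rw [hM, traceSnd_conj_kronecker _ hV2]; simpa using hd
  have hB : traceFst M = diagonal fun i => (e i : ℂ) := by
    rw [hM, traceFst_conj_kronecker _ hU2]; simpa using he
  have hdi : ∀ i, d i = ∑ k, (M (i, k) (i, k)).re := fun i => by
    simpa [traceSnd] using (congrArg Complex.re (congrFun₂ hA i i)).symm
  have hei : ∀ k, e k = ∑ i, (M (i, k) (i, k)).re := fun k => by
    simpa [traceFst] using (congrArg Complex.re (congrFun₂ hB k k)).symm
  rw [hSA, hSB, ← natEntropy_conj hW]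
  simp only [hdi, hei]
  exact (natEntropy_le_diag hMst).trans
    (sum_negMulLog_le_add_marginals hMst.re_diag_nonneg hMst.sum_re_diag)

lemma natEntropy_kronecker {ρ : Matrix P P ℂ} {σ : Matrix Q Q ℂ} (hρ : IsState ρ)
    (hσ : IsState σ) : natEntropy (ρ ⊗ₖ σ) = natEntropy ρ + natEntropy σ := by
  obtain ⟨U, d, hU, -, -, hd, -, hd1, hSA⟩ := hρ.exists_spectral_decomposition
  obtain ⟨V, e, hV, -, -, he, -, he1, hSB⟩ := hσ.exists_spectral_decomposition
  have h : ρ ⊗ₖ σ = (U ⊗ₖ V) * diagonal (fun x : P × Q => ((d x.1 * e x.2 : ℝ) : ℂ)) *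
      (U ⊗ₖ V)ᴴ := by
    conv_lhs => rw [hd, he]
    rw [mul_kronecker_mul, mul_kronecker_mul, diagonal_kronecker_diagonal,
      conjTranspose_kronecker]
    simp
  rw [h, natEntropy_conj (kronecker_isometry hU hV), natEntropy_diagonal, hSA, hSB,
    Fintype.sum_prod_type]
  simp only [negMulLog_mul, Finset.sum_add_distrib, ← Finset.mul_sum, ← Finset.sum_mul, he1, hd1,
    one_mul]

end Entropy

/-! ### Trace norm and continuity of the entropy -/

/-- `Δ` is a difference of positive operators of total trace at most `c`. For Hermitian `Δ` this
says `‖Δ‖₁ ≤ c`; in this form the bound passes to partial traces, tensor products and compressions,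
because positivity does. -/
def HasTraceBound {P : Type*} [Fintype P] (Δ : Matrix P P ℂ) (c : ℝ) : Prop :=
  ∃ S T : Matrix P P ℂ, S.PosSemidef ∧ T.PosSemidef ∧ Δ = S - T ∧ S.trace.re + T.trace.re ≤ c

section TraceBound

variable {P Q : Type*} [Fintype P] [Fintype Q]

lemma hasTraceBound_of_traceNorm_le [DecidableEq P] {Δ : Matrix P P ℂ} (hΔ : Δ.IsHermitian)
    {c : ℝ} (h : traceNorm Δ ≤ c) : HasTraceBound Δ c := by
  obtain ⟨U, d, h1, -, h3⟩ := exists_spectral_decomposition hΔ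
  have hsq : Δᴴ * Δ = U * diagonal (fun i => ((d i ^ 2 : ℝ) : ℂ)) * Uᴴ := by
    rw [hΔ.eq, h3, show ∀ D : Matrix P P ℂ, U * D * Uᴴ * (U * D * Uᴴ) =
      U * (D * (Uᴴ * U) * D) * Uᴴ from fun D => by simp only [Matrix.mul_assoc], h1,
      Matrix.mul_one, diagonal_mul_diagonal]
    simp [sq]
  have hnorm : traceNorm Δ = ∑ i, |d i| := by
    have hH := isHermitian_conjTranspose_mul_self Δ
    have h4 : (Δᴴ * Δ).charpoly.roots = Finset.univ.val.map fun i => ((d i ^ 2 : ℝ) : ℂ) := by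
      rw [hsq, charpoly_mul_comm, ← Matrix.mul_assoc, h1, Matrix.one_mul, roots_charpoly_diagonal]
    rw [hH.roots_charpoly_eq_eigenvalues] at h4
    have h5 := congrArg (fun s => (s.map fun z : ℂ => √z.re).sum) h4
    simp only [Multiset.map_map] at h5
    calc traceNorm Δ = ∑ i, √(d i ^ 2) := h5
      _ = _ := Finset.sum_congr rfl fun i _ => sqrt_sq_eq_abs _
  have htr : ∀ D : Matrix P P ℂ, (U * D * Uᴴ).trace = D.trace := fun D => by
    rw [trace_mul_comm, ← Matrix.mul_assoc, h1, Matrix.one_mul]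
  refine ⟨U * diagonal (fun i => ((max (d i) 0 : ℝ) : ℂ)) * Uᴴ,
    U * diagonal (fun i => ((max (-d i) 0 : ℝ) : ℂ)) * Uᴴ,
    (PosSemidef.diagonal fun i => ?_).mul_mul_conjTranspose_same U,
    (PosSemidef.diagonal fun i => ?_).mul_mul_conjTranspose_same U, ?_, ?_⟩
  · exact Complex.zero_le_real.2 (le_max_right _ _)
  · exact Complex.zero_le_real.2 (le_max_right _ _)
  · conv_lhs => rw [h3]
    rw [← Matrix.sub_mul, ← Matrix.mul_sub, diagonal_sub]
    congr 3
    funext i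
    rw [← Complex.ofReal_sub]
    congr 1
    rcases le_total 0 (d i) with h | h
    · rw [max_eq_left h, max_eq_right (by linarith), sub_zero]
    · rw [max_eq_right h, max_eq_left (by linarith)]; ring
  · rw [htr, htr, trace_diagonal, trace_diagonal, ← Complex.add_re, ← Finset.sum_add_distrib]
    refine le_trans (le_of_eq ?_) (hnorm ▸ h)
    rw [Complex.re_sum]
    refine Finset.sum_congr rfl fun i _ => ?_
    rw [← Complex.ofReal_add, Complex.ofReal_re]
    rcases le_total 0 (d i) with h | h
    · rw [max_eq_left h, max_eq_right (by linarith), abs_of_nonneg h, add_zero]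
    · rw [max_eq_right h, max_eq_left (by linarith), abs_of_nonpos h, zero_add]

lemma HasTraceBound.add {Δ Δ' : Matrix P P ℂ} {c c' : ℝ} (h : HasTraceBound Δ c)
    (h' : HasTraceBound Δ' c') : HasTraceBound (Δ + Δ') (c + c') := by
  obtain ⟨S, T, hS, hT, rfl, hc⟩ := h
  obtain ⟨S', T', hS', hT', rfl, hc'⟩ := h'
  refine ⟨S + S', T + T', hS.add hS', hT.add hT', by abel, ?_⟩
  simp only [trace_add, Complex.add_re]
  linarith

lemma HasTraceBound.neg {Δ : Matrix P P ℂ} {c : ℝ} (h : HasTraceBound Δ c) :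
    HasTraceBound (-Δ) c := by
  obtain ⟨S, T, hS, hT, rfl, hc⟩ := h
  exact ⟨T, S, hT, hS, by abel, by linarith⟩

lemma HasTraceBound.traceSnd {Δ : Matrix (P × Q) (P × Q) ℂ} {c : ℝ} (h : HasTraceBound Δ c) :
    HasTraceBound (traceSnd Δ) c := by
  obtain ⟨S, T, hS, hT, rfl, hc⟩ := h
  refine ⟨_, _, posSemidef_traceSnd hS, posSemidef_traceSnd hT, ?_, ?_⟩
  · ext a b
    simp [QErasure.traceSnd]
  · rwa [trace_traceSnd, trace_traceSnd]

lemma HasTraceBound.traceFst {Δ : Matrix (P × Q) (P × Q) ℂ} {c : ℝ} (h : HasTraceBound Δ c) :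
    HasTraceBound (traceFst Δ) c := by
  obtain ⟨S, T, hS, hT, rfl, hc⟩ := h
  refine ⟨_, _, posSemidef_traceFst hS, posSemidef_traceFst hT, ?_, ?_⟩
  · ext a b
    simp [QErasure.traceFst]
  · rwa [trace_traceFst, trace_traceFst]

lemma HasTraceBound.kronecker_state {Δ : Matrix P P ℂ} {c : ℝ} (h : HasTraceBound Δ c)
    {ω : Matrix Q Q ℂ} (hω : IsState ω) : HasTraceBound (Δ ⊗ₖ ω) c := by
  obtain ⟨S, T, hS, hT, rfl, hc⟩ := h
  classical
  refine ⟨_, _, hS.kronecker hω.1, hT.kronecker hω.1, ?_, ?_⟩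
  · ext a b
    simp [sub_mul]
  · rwa [trace_kronecker, trace_kronecker, hω.2, mul_one, mul_one]

lemma HasTraceBound.state_kronecker {Δ : Matrix P P ℂ} {c : ℝ} (h : HasTraceBound Δ c)
    {ω : Matrix Q Q ℂ} (hω : IsState ω) : HasTraceBound (ω ⊗ₖ Δ) c := by
  obtain ⟨S, T, hS, hT, rfl, hc⟩ := h
  classical
  refine ⟨_, _, hω.1.kronecker hS, hω.1.kronecker hT, ?_, ?_⟩
  · ext a b
    simp [mul_sub]
  · rwa [trace_kronecker, trace_kronecker, hω.2, one_mul, one_mul]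

/-- Compressing a positive operator to a subspace does not increase its trace. -/
lemma trace_compress_le [DecidableEq P] [DecidableEq Q] {S : Matrix P P ℂ} (hS : S.PosSemidef)
    {W : Matrix P Q ℂ} (hW : Wᴴ * W = 1) : (Wᴴ * S * W).trace.re ≤ S.trace.re := by
  set E : Matrix P P ℂ := 1 - W * Wᴴ with hE
  have hEH : Eᴴ = E := by simp [hE]
  have hEE : E * E = E := by
    have : W * Wᴴ * (W * Wᴴ) = W * Wᴴ := by
      rw [Matrix.mul_assoc, ← Matrix.mul_assoc Wᴴ, hW, Matrix.one_mul]
    simp [hE, Matrix.sub_mul, Matrix.mul_sub, this]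
  have h1 : 0 ≤ (E * S * Eᴴ).trace.re :=
    (Complex.nonneg_iff.1 (hS.mul_mul_conjTranspose_same E).trace_nonneg).1
  have h2 : (E * S * Eᴴ).trace = S.trace - (Wᴴ * S * W).trace := by
    rw [hEH, trace_mul_comm, ← Matrix.mul_assoc, hEE, hE, Matrix.sub_mul, Matrix.one_mul,
      trace_sub, Matrix.mul_assoc, trace_mul_comm W]
  rw [h2, Complex.sub_re] at h1
  linarith

lemma HasTraceBound.compress [DecidableEq P] [DecidableEq Q] {Δ : Matrix P P ℂ} {c : ℝ}
    (h : HasTraceBound Δ c) {W : Matrix P Q ℂ} (hW : Wᴴ * W = 1) :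
    HasTraceBound (Wᴴ * Δ * W) c := by
  obtain ⟨S, T, hS, hT, rfl, hc⟩ := h
  refine ⟨_, _, hS.conjTranspose_mul_mul_same W, hT.conjTranspose_mul_mul_same W, ?_, ?_⟩
  · rw [Matrix.mul_sub, Matrix.sub_mul]
  · linarith [trace_compress_le hS hW, trace_compress_le hT hW]

lemma HasTraceBound.sum_abs_diag_le {Δ : Matrix P P ℂ} {c : ℝ} (h : HasTraceBound Δ c) :
    ∑ i, |(Δ i i).re| ≤ c := by
  obtain ⟨S, T, hS, hT, rfl, hc⟩ := h
  refine le_trans ?_ hc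
  simp only [trace, Complex.re_sum, diag_apply]
  rw [← Finset.sum_add_distrib]
  refine Finset.sum_le_sum fun i _ => ?_
  have h1 := (Complex.nonneg_iff.1 (hS.diag_nonneg (i := i))).1
  have h2 := (Complex.nonneg_iff.1 (hT.diag_nonneg (i := i))).1
  rw [Matrix.sub_apply, Complex.sub_re, abs_le]
  constructor <;> linarith

end TraceBound

section Continuity

variable {P Q : Type*} [Fintype P] [DecidableEq P] [Fintype Q] [DecidableEq Q]

/-- Fannes' inequality. Measuring `τ` in the eigenbasis of `σ` only increases its entropy, so it
suffices to compare two probability distributions. -/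
lemma natEntropy_sub_le {σ τ : Matrix P P ℂ} (hσ : IsState σ) (hτ : IsState τ) {c : ℝ}
    (h : HasTraceBound (τ - σ) c) :
    natEntropy τ - natEntropy σ ≤ c * log (Fintype.card P) + etaNat c := by
  obtain ⟨U, d, h1, h2, h3, -, hd, hd1, hS⟩ := hσ.exists_spectral_decomposition
  have hU : Uᴴᴴ * Uᴴ = 1 := by rwa [conjTranspose_conjTranspose]
  have hst := hτ.conj hU
  have hent := natEntropy_conj hU τ
  rw [conjTranspose_conjTranspose] at hst hent
  have hdiff := (h.compress h1).sum_abs_diag_le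
  have := sum_negMulLog_sub_le hd hst.re_diag_nonneg hd1 hst.sum_re_diag (Δ := c) (by
    refine le_trans (le_of_eq (Finset.sum_congr rfl fun i _ => ?_)) hdiff
    rw [Matrix.mul_sub, Matrix.sub_mul, h3]
    simp)
  have h5 := natEntropy_le_diag hst
  rw [hS]
  linarith

/-- A projection is `W Wᴴ` for an isometry `W` from a space whose dimension is its rank. -/
lemma exists_isometry_of_isStarProjection {E : Matrix P P ℂ} (hE : IsStarProjection E) :
    ∃ W : Matrix P (Fin E.rank) ℂ, Wᴴ * W = 1 ∧ W * Wᴴ = E := by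
  have hH : E.IsHermitian := hE.isSelfAdjoint
  set U : Matrix P P ℂ := (hH.eigenvectorUnitary : Matrix P P ℂ)
  set d := hH.eigenvalues
  have h1 : Uᴴ * U = 1 := Unitary.coe_star_mul_self _
  have h3 : E = U * diagonal (fun i => (d i : ℂ)) * Uᴴ := hH.spectral_theorem
  have h4 : Uᴴ * E * U = diagonal (fun i => (d i : ℂ)) := by
    rw [h3, show ∀ D : Matrix P P ℂ, Uᴴ * (U * D * Uᴴ) * U = (Uᴴ * U) * D * (Uᴴ * U) from
      fun D => by simp only [Matrix.mul_assoc], h1, Matrix.one_mul, Matrix.mul_one]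
  have hdd : ∀ i, d i ≠ 0 → d i = 1 := fun i hi => by
    have h5 : diagonal (fun i => (d i : ℂ)) * diagonal (fun i => (d i : ℂ)) =
        diagonal (fun i => (d i : ℂ)) := by
      have h2 : U * Uᴴ = 1 := Unitary.coe_mul_star_self _
      rw [← h4, show Uᴴ * E * U * (Uᴴ * E * U) = Uᴴ * (E * (U * Uᴴ) * E) * U by
        simp only [Matrix.mul_assoc], h2, Matrix.mul_one, hE.isIdempotentElem.eq]
    rw [diagonal_mul_diagonal] at h5
    have h6 := congrFun (diagonal_injective h5) i
    have h7 : d i * d i = d i := by exact_mod_cast h6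
    exact mul_right_cancel₀ hi (h7.trans (one_mul _).symm)
  let e : Fin E.rank ≃ {i // d i ≠ 0} :=
    (Fintype.equivFinOfCardEq hH.rank_eq_card_non_zero_eigs.symm).symm
  refine ⟨U.submatrix id fun k => (e k : P), ?_, ?_⟩
  · have : (U.submatrix id fun k => (e k : P))ᴴ * (U.submatrix id fun k => (e k : P)) =
        (Uᴴ * U).submatrix (fun k => (e k : P)) fun k => (e k : P) := rfl
    rw [this, h1]
    exact submatrix_one _ (Subtype.val_injective.comp e.injective)
  · ext a b
    conv_rhs => rw [h3]
    rw [mul_apply, mul_apply]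
    simp only [submatrix_apply, conjTranspose_apply, id, mul_diagonal]
    rw [e.sum_comp fun i : {i // d i ≠ 0} => U a i * star (U b i),
      ← Finset.sum_subtype (Finset.univ.filter fun i => d i ≠ 0) (by simp)
        (f := fun i => U a i * star (U b i)), Finset.sum_filter]
    refine Finset.sum_congr rfl fun i _ => ?_
    split_ifs with h
    · simp [hdd i h]
    · simp [not_not.1 h]

/-- A state close to a product state, with local support of dimension at most `D`, has small
mutual information: it is `3 ε`-close to the product of its own marginals. -/
lemma mutual_information_le {σ : Matrix (P × Q) (P × Q) ℂ} (hσ : IsState σ)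
    {ωA : Matrix P P ℂ} {ωB : Matrix Q Q ℂ} (hA : IsState ωA) (hB : IsState ωB) {ε D : ℝ}
    (h : HasTraceBound (σ - ωA ⊗ₖ ωB) ε) (hε : 0 ≤ ε) (hD : HasLocalSupport σ D) :
    natEntropy (traceSnd σ) + natEntropy (traceFst σ) - natEntropy σ ≤
      3 * ε * log D + etaNat (3 * ε) := by
  obtain ⟨E, F, hE, hF, hsupp, hrank⟩ := hD
  obtain ⟨V, hV, hV'⟩ := exists_isometry_of_isStarProjection hE
  obtain ⟨X, hX, hX'⟩ := exists_isometry_of_isStarProjection hF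
  have hW := kronecker_isometry hV hX
  have hW' : (V ⊗ₖ X) * (V ⊗ₖ X)ᴴ = E ⊗ₖ F := by
    rw [conjTranspose_kronecker, ← mul_kronecker_mul, hV', hX']
  have hsupp' : σ * (E ⊗ₖ F) = σ := by
    have := congrArg conjTranspose hsupp
    rwa [conjTranspose_mul, hσ.1.isHermitian.eq, ← hW', conjTranspose_mul,
      conjTranspose_conjTranspose, hW'] at this
  set W := V ⊗ₖ X with hWdef
  set σ' := Wᴴ * σ * W with hσ'
  have hσσ' : σ = W * σ' * Wᴴ := by
    rw [hσ', show W * (Wᴴ * σ * W) * Wᴴ = (W * Wᴴ) * σ * (W * Wᴴ) by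
      simp only [Matrix.mul_assoc], hW', hsupp, hsupp']
  have hst : IsState σ' := ⟨hσ.1.conjTranspose_mul_mul_same W, by
    rw [hσ', Matrix.mul_assoc, trace_mul_comm, Matrix.mul_assoc, hW', hsupp', hσ.2]⟩
  have hmA : traceSnd σ = V * traceSnd σ' * Vᴴ := by
    rw [hσσ', hWdef, traceSnd_conj_kronecker _ hX]
  have hmB : traceFst σ = X * traceFst σ' * Xᴴ := by
    rw [hσσ', hWdef, traceFst_conj_kronecker _ hV]
  have hprod : Wᴴ * (traceSnd σ ⊗ₖ traceFst σ) * W = traceSnd σ' ⊗ₖ traceFst σ' := by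
    have : traceSnd σ ⊗ₖ traceFst σ = W * (traceSnd σ' ⊗ₖ traceFst σ') * Wᴴ := by
      rw [hmA, hmB, mul_kronecker_mul, mul_kronecker_mul, hWdef, conjTranspose_kronecker]
    rw [this, show ∀ Y, Wᴴ * (W * Y * Wᴴ) * W = (Wᴴ * W) * Y * (Wᴴ * W) from
      fun Y => by simp only [Matrix.mul_assoc], hW, Matrix.one_mul, Matrix.mul_one]
  have hbA : HasTraceBound (traceSnd σ - ωA) ε := by
    have := h.traceSnd
    rwa [show traceSnd (σ - ωA ⊗ₖ ωB) = traceSnd σ - traceSnd (ωA ⊗ₖ ωB) by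
      ext a b; simp [traceSnd], traceSnd_kronecker, hB.2, one_smul] at this
  have hbB : HasTraceBound (traceFst σ - ωB) ε := by
    have := h.traceFst
    rwa [show traceFst (σ - ωA ⊗ₖ ωB) = traceFst σ - traceFst (ωA ⊗ₖ ωB) by
      ext a b; simp [traceFst], traceFst_kronecker, hA.2, one_smul] at this
  have hb : HasTraceBound (traceSnd σ' ⊗ₖ traceFst σ' - σ') (3 * ε) := by
    have := (((h.neg.add (hbA.kronecker_state hB)).add
      (hbB.state_kronecker hσ.traceSnd))).compress hW
    have heq : -(σ - ωA ⊗ₖ ωB) + (traceSnd σ - ωA) ⊗ₖ ωB + traceSnd σ ⊗ₖ (traceFst σ - ωB) =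
        traceSnd σ ⊗ₖ traceFst σ - σ := by
      ext a b
      simp
      ring
    rw [heq, Matrix.mul_sub, Matrix.sub_mul, hprod, ← hσ'] at this
    convert this using 1
    ring
  have key := natEntropy_sub_le hst (hst.traceSnd.kronecker hst.traceFst) hb
  rw [natEntropy_kronecker hst.traceSnd hst.traceFst] at key
  have hcard : (Fintype.card (Fin E.rank × Fin F.rank) : ℝ) = E.rank * F.rank := by simp
  have hpos : 0 < Fintype.card (Fin E.rank × Fin F.rank) := by
    refine Nat.pos_of_ne_zero fun h0 => ?_
    have := Fintype.card_eq_zero_iff.1 h0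
    have h1 := hst.2
    rw [trace, Finset.univ_eq_empty, Finset.sum_empty] at h1
    exact zero_ne_one h1
  have hlog : log (Fintype.card (Fin E.rank × Fin F.rank)) ≤ log D :=
    log_le_log (by exact_mod_cast hpos) (hcard.trans_le hrank)
  have h1 : natEntropy (traceSnd σ) = natEntropy (traceSnd σ') := by rw [hmA, natEntropy_conj hV]
  have h2 : natEntropy (traceFst σ) = natEntropy (traceFst σ') := by rw [hmB, natEntropy_conj hX]
  have h3 : natEntropy σ = natEntropy σ' := by
    conv_lhs => rw [hσσ', natEntropy_conj hW]
  have h4 := mul_le_mul_of_nonneg_left hlog (by positivity : 0 ≤ 3 * ε)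
  linarith

end Continuity

/-! ### Tensor powers -/

/-- `M^{⊗ n}` as an operator on the system `Fin n → P`. -/
def kroneckerPow {P : Type*} (M : Matrix P P ℂ) (n : ℕ) : Matrix (Fin n → P) (Fin n → P) ℂ :=
  fun x y => ∏ i, M (x i) (y i)

section TensorPower

variable {P A B : Type*}

lemma kroneckerPow_succ (M : Matrix P P ℂ) (n : ℕ) :
    kroneckerPow M (n + 1) = (M ⊗ₖ kroneckerPow M n).submatrix
      (Fin.consEquiv fun _ => P).symm (Fin.consEquiv fun _ => P).symm := by
  ext x y
  simp only [kroneckerPow, Fin.prod_univ_succ, submatrix_apply, kroneckerMap_apply]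
  rfl

lemma tensorPow_eq_submatrix (ρ : Matrix (A × B) (A × B) ℂ) (n : ℕ) :
    tensorPow ρ n = (kroneckerPow ρ n).submatrix (Equiv.arrowProdEquivProdArrow _ _ _).symm
      (Equiv.arrowProdEquivProdArrow _ _ _).symm := rfl

lemma traceSnd_tensorPow [Fintype B] (ρ : Matrix (A × B) (A × B) ℂ) (n : ℕ) :
    traceSnd (tensorPow ρ n) = kroneckerPow (traceSnd ρ) n := by
  classical
  ext x y
  simp only [traceSnd, tensorPow, kroneckerPow, Finset.prod_univ_sum, Fintype.piFinset_univ]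

lemma traceFst_tensorPow [Fintype A] (ρ : Matrix (A × B) (A × B) ℂ) (n : ℕ) :
    traceFst (tensorPow ρ n) = kroneckerPow (traceFst ρ) n := by
  classical
  ext x y
  simp only [traceFst, tensorPow, kroneckerPow, Finset.prod_univ_sum, Fintype.piFinset_univ]

variable [Fintype P] [DecidableEq P] [Fintype A] [Fintype B]

lemma IsState.kroneckerPow {ρ : Matrix P P ℂ} (hρ : IsState ρ) (n : ℕ) :
    IsState (kroneckerPow ρ n) := by
  induction n with
  | zero =>
    have : QErasure.kroneckerPow ρ 0 = 1 := by
      ext x y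
      rw [Subsingleton.elim y x, one_apply_eq]
      rfl
    rw [this]
    exact ⟨PosSemidef.one, by simp⟩
  | succ n ih =>
    rw [kroneckerPow_succ]
    exact (hρ.kronecker ih).submatrix_equiv _

lemma natEntropy_kroneckerPow {ρ : Matrix P P ℂ} (hρ : IsState ρ) (n : ℕ) :
    natEntropy (kroneckerPow ρ n) = n * natEntropy ρ := by
  induction n with
  | zero =>
    have h := hρ.kroneckerPow 0
    refine le_antisymm ((natEntropy_le_diag h).trans (le_of_eq ?_)) ?_
    · simp [kroneckerPow]
    · simpa using natEntropy_nonneg h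
  | succ n ih =>
    rw [kroneckerPow_succ, natEntropy_submatrix_equiv, natEntropy_kronecker hρ (hρ.kroneckerPow n),
      ih]
    push_cast
    ring

lemma IsState.tensorPow {ρ : Matrix (A × B) (A × B) ℂ} (hρ : IsState ρ) (n : ℕ) :
    IsState (tensorPow ρ n) := by
  classical
  rw [tensorPow_eq_submatrix]
  exact (hρ.kroneckerPow n).submatrix_equiv _

lemma natEntropy_tensorPow [DecidableEq A] [DecidableEq B] {ρ : Matrix (A × B) (A × B) ℂ}
    (hρ : IsState ρ) (n : ℕ) : natEntropy (tensorPow ρ n) = n * natEntropy ρ := by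
  rw [tensorPow_eq_submatrix, natEntropy_submatrix_equiv, natEntropy_kroneckerPow hρ]

end TensorPower

/-! ### Pure states -/

section Pure

variable {P Q : Type*} [Fintype P] [Fintype Q]

lemma posSemidef_proj (φ : P → ℂ) : (proj φ).PosSemidef :=
  posSemidef_vecMulVec_self_star φ

/-- The two marginals of a pure state have the same entropy (Schmidt decomposition). -/
lemma natEntropy_traceFst_proj [DecidableEq P] [DecidableEq Q] (φ : P × Q → ℂ) :
    natEntropy (traceFst (proj φ)) = natEntropy (traceSnd (proj φ)) := by
  let F : Matrix P Q ℂ := fun x y => φ (x, y)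
  have h1 : traceSnd (proj φ) = F * Fᴴ := rfl
  have h2 : traceFst (proj φ) = (Fᴴ * F)ᵀ := by
    ext a b
    exact Finset.sum_congr rfl fun x _ => mul_comm _ _
  rw [h1, h2, natEntropy_transpose, natEntropy_mul_comm]

open scoped MatrixOrder in
lemma exists_isPurification {ρ : Matrix P P ℂ} (hρ : ρ.PosSemidef) :
    ∃ ψ : P × P → ℂ, IsPurification ψ ρ := by
  classical
  obtain ⟨C, hC⟩ : ∃ C : Matrix P P ℂ, ρ = Cᴴ * C :=
    CStarAlgebra.nonneg_iff_eq_star_mul_self.1 hρ.nonneg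
  refine ⟨fun x => star (C x.1 x.2), ?_⟩
  ext a b
  rw [hC]
  simp [traceFst, proj, vecMulVec_apply, mul_apply]

end Pure

/-! ### The environment of a COLUR map -/

namespace LocalUnitaryEnsemble

variable {A B Z : Type*} [Fintype A] [DecidableEq A] [Fintype B] [DecidableEq B]

/-- The product unitary `Uᵢ ⊗ Vᵢ`. -/
def localUnitary (R : LocalUnitaryEnsemble A B) (i : Fin R.N) : Matrix (A × B) (A × B) ℂ :=
  (R.U i : Matrix A A ℂ) ⊗ₖ (R.V i : Matrix B B ℂ)

lemma U_isometry (R : LocalUnitaryEnsemble A B) (i : Fin R.N) :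
    (R.U i : Matrix A A ℂ)ᴴ * (R.U i : Matrix A A ℂ) = 1 := Unitary.coe_star_mul_self _

lemma V_isometry (R : LocalUnitaryEnsemble A B) (i : Fin R.N) :
    (R.V i : Matrix B B ℂ)ᴴ * (R.V i : Matrix B B ℂ) = 1 := Unitary.coe_star_mul_self _

lemma localUnitary_isometry (R : LocalUnitaryEnsemble A B) (i : Fin R.N) :
    (R.localUnitary i)ᴴ * R.localUnitary i = 1 :=
  kronecker_isometry (R.U_isometry i) (R.V_isometry i)

lemma map_eq_sum (R : LocalUnitaryEnsemble A B) (σ : Matrix (A × B) (A × B) ℂ) :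
    R.map σ = ∑ i, (R.p i : ℂ) • (R.localUnitary i * σ * (R.localUnitary i)ᴴ) := rfl

lemma sum_p_coe (R : LocalUnitaryEnsemble A B) : ∑ i, (R.p i : ℂ) = 1 := by
  exact_mod_cast R.p_sum

lemma isState_mix {P : Type*} [Fintype P] (R : LocalUnitaryEnsemble A B)
    {σ : Fin R.N → Matrix P P ℂ} (hσ : ∀ i, IsState (σ i)) :
    IsState (∑ i, (R.p i : ℂ) • σ i) := by
  refine ⟨posSemidef_sum _ fun i _ => (hσ i).1.smul (Complex.zero_le_real.2 (R.p_nonneg i)), ?_⟩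
  simp [trace_sum, trace_smul, (hσ _).2, R.sum_p_coe]

lemma isState_map (R : LocalUnitaryEnsemble A B) {σ : Matrix (A × B) (A × B) ℂ}
    (hσ : IsState σ) : IsState (R.map σ) :=
  R.isState_mix fun i => hσ.conj (R.localUnitary_isometry i)

lemma traceSnd_sum_smul {P Q ι : Type*} [Fintype Q] [Fintype ι] (c : ι → ℂ)
    (X : ι → Matrix (P × Q) (P × Q) ℂ) :
    traceSnd (∑ i, c i • X i) = ∑ i, c i • traceSnd (X i) := by
  ext a b
  simp only [traceSnd, Matrix.sum_apply, Matrix.smul_apply, smul_eq_mul, Finset.mul_sum]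
  exact Finset.sum_comm

lemma traceFst_sum_smul {P Q ι : Type*} [Fintype P] [Fintype ι] (c : ι → ℂ)
    (X : ι → Matrix (P × Q) (P × Q) ℂ) :
    traceFst (∑ i, c i • X i) = ∑ i, c i • traceFst (X i) := by
  ext a b
  simp only [traceFst, Matrix.sum_apply, Matrix.smul_apply, smul_eq_mul, Finset.mul_sum]
  exact Finset.sum_comm

lemma traceSnd_map (R : LocalUnitaryEnsemble A B) (σ : Matrix (A × B) (A × B) ℂ) :
    traceSnd (R.map σ) =
      ∑ i, (R.p i : ℂ) • ((R.U i : Matrix A A ℂ) * traceSnd σ * (R.U i : Matrix A A ℂ)ᴴ) := by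
  rw [map_eq_sum, traceSnd_sum_smul]
  simp only [localUnitary, traceSnd_conj_kronecker _ (R.V_isometry _)]

lemma traceFst_map (R : LocalUnitaryEnsemble A B) (σ : Matrix (A × B) (A × B) ℂ) :
    traceFst (R.map σ) =
      ∑ i, (R.p i : ℂ) • ((R.V i : Matrix B B ℂ) * traceFst σ * (R.V i : Matrix B B ℂ)ᴴ) := by
  rw [map_eq_sum, traceFst_sum_smul]
  simp only [localUnitary, traceFst_conj_kronecker _ (R.U_isometry _)]

lemma natEntropy_traceSnd_le_map (R : LocalUnitaryEnsemble A B) {σ : Matrix (A × B) (A × B) ℂ}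
    (hσ : IsState σ) : natEntropy (traceSnd σ) ≤ natEntropy (traceSnd (R.map σ)) := by
  rw [traceSnd_map]
  have hst := fun i => hσ.traceSnd.conj (R.U_isometry i)
  refine le_trans (le_of_eq ?_) (sum_mul_natEntropy_le R.p_nonneg R.p_sum hst (R.isState_mix hst))
  simp only [natEntropy_conj (R.U_isometry _), ← Finset.sum_mul, R.p_sum, one_mul]

lemma natEntropy_traceFst_le_map (R : LocalUnitaryEnsemble A B) {σ : Matrix (A × B) (A × B) ℂ}
    (hσ : IsState σ) : natEntropy (traceFst σ) ≤ natEntropy (traceFst (R.map σ)) := by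
  rw [traceFst_map]
  have hst := fun i => hσ.traceFst.conj (R.V_isometry i)
  refine le_trans (le_of_eq ?_) (sum_mul_natEntropy_le R.p_nonneg R.p_sum hst (R.isState_mix hst))
  simp only [natEntropy_conj (R.V_isometry _), ← Finset.sum_mul, R.p_sum, one_mul]

/-- The vector `∑ᵢ √pᵢ (Uᵢ ⊗ Vᵢ) ψ ⊗ |i⟩`: the joint pure output of reference, system and
environment when `R` is applied coherently to `ψ`. The index is grouped as reference and
environment against system. -/
noncomputable def dilation (R : LocalUnitaryEnsemble A B) (ψ : Z × (A × B) → ℂ) :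
    (Z × Fin R.N) × (A × B) → ℂ :=
  fun w => (√(R.p w.1.2) : ℂ) * (R.localUnitary w.1.2 *ᵥ fun y => ψ (w.1.1, y)) w.2

lemma dilation_mul_star (R : LocalUnitaryEnsemble A B) (ψ : Z × (A × B) → ℂ) (z z' : Z)
    (i : Fin R.N) (x x' : A × B) :
    R.dilation ψ ((z, i), x) * star (R.dilation ψ ((z', i), x')) =
      R.p i * ((R.localUnitary i *ᵥ fun y => ψ (z, y)) x *
        star ((R.localUnitary i *ᵥ fun y => ψ (z', y)) x')) := by
  have h : (√(R.p i) : ℂ) * √(R.p i) = R.p i := by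
    rw [← Complex.ofReal_mul, mul_self_sqrt (R.p_nonneg i)]
  simp only [dilation, star_mul', ← h, Complex.star_def, Complex.conj_ofReal]
  ring

lemma map_vecMulVec (R : LocalUnitaryEnsemble A B) (u v : A × B → ℂ) (x x' : A × B) :
    R.map (vecMulVec u (star v)) x x' =
      ∑ i, R.p i * ((R.localUnitary i *ᵥ u) x * star ((R.localUnitary i *ᵥ v) x')) := by
  rw [map_eq_sum, Matrix.sum_apply]
  refine Finset.sum_congr rfl fun i _ => ?_
  rw [Matrix.smul_apply, mul_vecMulVec, vecMulVec_mul, ← star_mulVec]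
  rfl

lemma localUnitary_dotProduct (R : LocalUnitaryEnsemble A B) (i : Fin R.N) (u v : A × B → ℂ) :
    ∑ x, (R.localUnitary i *ᵥ u) x * star ((R.localUnitary i *ᵥ v) x) = ∑ x, u x * star (v x) := by
  have h : star (R.localUnitary i *ᵥ v) ⬝ᵥ (R.localUnitary i *ᵥ u) = star v ⬝ᵥ u := by
    rw [star_mulVec, ← dotProduct_mulVec, mulVec_mulVec, R.localUnitary_isometry, one_mulVec]
  simpa only [dotProduct, Pi.star_apply, mul_comm] using h

lemma traceSnd_traceSnd_proj_dilation (R : LocalUnitaryEnsemble A B) (ψ : Z × (A × B) → ℂ) :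
    traceSnd (traceSnd (proj (R.dilation ψ))) = traceSnd (proj ψ) := by
  ext z z'
  simp only [traceSnd, proj, vecMulVec_apply, Pi.star_apply, dilation_mul_star, ← Finset.mul_sum,
    localUnitary_dotProduct, ← Finset.sum_mul, R.sum_p_coe, one_mul]

/-- The dilation grouped as reference and system against environment. -/
noncomputable def dilationEnv (R : LocalUnitaryEnsemble A B) (ψ : Z × (A × B) → ℂ) :
    (Z × (A × B)) × Fin R.N → ℂ :=
  fun w => R.dilation ψ ((w.1.1, w.2), w.1.2)

lemma traceSnd_proj_dilationEnv (R : LocalUnitaryEnsemble A B) (ψ : Z × (A × B) → ℂ) :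
    traceSnd (proj (R.dilationEnv ψ)) = idTensor Z R.map (proj ψ) := by
  ext ⟨z, x⟩ ⟨z', x'⟩
  simp only [traceSnd, proj, vecMulVec_apply, Pi.star_apply, dilationEnv, dilation_mul_star]
  exact (R.map_vecMulVec (fun y => ψ (z, y)) (fun y => ψ (z', y)) x x').symm

variable [Fintype Z]

lemma traceFst_proj_dilation (R : LocalUnitaryEnsemble A B) (ψ : Z × (A × B) → ℂ) :
    traceFst (proj (R.dilation ψ)) = R.map (traceFst (proj ψ)) := by
  have h : traceFst (proj ψ) =
      ∑ z, vecMulVec (fun y => ψ (z, y)) (star fun y => ψ (z, y)) := by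
    ext a b
    rw [Matrix.sum_apply]
    rfl
  ext x x'
  rw [h, map_sum, Matrix.sum_apply]
  simp only [map_vecMulVec, traceFst, proj, vecMulVec_apply, Pi.star_apply, Fintype.sum_prod_type,
    dilation_mul_star]

lemma traceFst_traceSnd_proj_dilation_diag (R : LocalUnitaryEnsemble A B)
    {ψ : Z × (A × B) → ℂ} (hψ : (proj ψ).trace = 1) (i : Fin R.N) :
    traceFst (traceSnd (proj (R.dilation ψ))) i i = R.p i := by
  simp only [traceSnd, traceFst, proj, vecMulVec_apply, Pi.star_apply, dilation_mul_star,
    ← Finset.mul_sum, localUnitary_dotProduct]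
  rw [trace, Fintype.sum_prod_type] at hψ
  exact (congrArg _ hψ).trans (mul_one _)

lemma traceFst_proj_dilationEnv (R : LocalUnitaryEnsemble A B) (ψ : Z × (A × B) → ℂ) :
    traceFst (proj (R.dilationEnv ψ)) = traceFst (traceSnd (proj (R.dilation ψ))) := by
  ext i j
  simp only [traceFst, traceSnd, Fintype.sum_prod_type (α₁ := Z)]
  rfl

lemma isState_proj_dilation (R : LocalUnitaryEnsemble A B) {σ : Matrix (A × B) (A × B) ℂ}
    (hσ : IsState σ) {ψ : Z × (A × B) → ℂ} (hψ : IsPurification ψ σ) :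
    IsState (proj (R.dilation ψ)) :=
  ⟨posSemidef_proj _, by
    rw [← trace_traceFst, traceFst_proj_dilation, hψ, (R.isState_map hσ).2]⟩

lemma isState_idTensor (R : LocalUnitaryEnsemble A B) {σ : Matrix (A × B) (A × B) ℂ}
    (hσ : IsState σ) {ψ : Z × (A × B) → ℂ} (hψ : IsPurification ψ σ) :
    IsState (idTensor Z R.map (proj ψ)) := by
  rw [← traceSnd_proj_dilationEnv]
  refine ⟨posSemidef_traceSnd (posSemidef_proj _), ?_⟩
  rw [trace_traceSnd, ← trace_traceFst, traceFst_proj_dilationEnv]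
  exact (R.isState_proj_dilation hσ hψ).traceSnd.traceFst.2

variable [DecidableEq Z]

/-- The entropy exchange is the entropy of the environment. -/
lemma natEntropy_idTensor (R : LocalUnitaryEnsemble A B) (ψ : Z × (A × B) → ℂ) :
    natEntropy (idTensor Z R.map (proj ψ)) =
      natEntropy (traceFst (traceSnd (proj (R.dilation ψ)))) := by
  rw [← traceSnd_proj_dilationEnv, ← natEntropy_traceFst_proj, traceFst_proj_dilationEnv]

/-- The entropy of the output is that of reference and environment, and the reference keeps the
entropy of the input. -/
lemma natEntropy_map_le (R : LocalUnitaryEnsemble A B) {σ : Matrix (A × B) (A × B) ℂ}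
    (hσ : IsState σ) {ψ : Z × (A × B) → ℂ} (hψ : IsPurification ψ σ) :
    natEntropy (R.map σ) ≤ natEntropy σ + natEntropy (idTensor Z R.map (proj ψ)) := by
  have h := natEntropy_le_add_marginals (R.isState_proj_dilation hσ hψ).traceSnd
  rwa [← natEntropy_traceFst_proj, traceFst_proj_dilation, traceSnd_traceSnd_proj_dilation,
    ← natEntropy_traceFst_proj, hψ, ← natEntropy_idTensor] at h

/-- Measuring the environment in the basis `|i⟩` yields the distribution `p`. -/
lemma natEntropy_idTensor_le (R : LocalUnitaryEnsemble A B) {σ : Matrix (A × B) (A × B) ℂ}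
    (hσ : IsState σ) {ψ : Z × (A × B) → ℂ} (hψ : IsPurification ψ σ) :
    natEntropy (idTensor Z R.map (proj ψ)) ≤ ∑ i, negMulLog (R.p i) := by
  have htr : (proj ψ).trace = 1 := by rw [← trace_traceFst, hψ, hσ.2]
  rw [natEntropy_idTensor]
  refine (natEntropy_le_diag (R.isState_proj_dilation hσ hψ).traceSnd.traceFst).trans
    (le_of_eq (Finset.sum_congr rfl fun i _ => ?_))
  rw [R.traceFst_traceSnd_proj_dilation_diag htr, Complex.ofReal_re]

end LocalUnitaryEnsemble

/-! ### The lower bound on the entropy exchange -/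

variable {A B Z : Type*} [Fintype A] [DecidableEq A] [Fintype B] [DecidableEq B]
  [Fintype Z] [DecidableEq Z]

lemma traceNorm_nonneg {P : Type*} [Fintype P] [DecidableEq P] (M : Matrix P P ℂ) :
    0 ≤ traceNorm M :=
  Finset.sum_nonneg fun _ _ => sqrt_nonneg _

/-- The lower bound on the entropy exchange, in natural units. -/
lemma le_natEntropy_idTensor {ρ : Matrix (A × B) (A × B) ℂ} (hρ : IsState ρ) {n : ℕ} {ε d : ℝ}
    (R : LocalUnitaryEnsemble (Fin n → A) (Fin n → B))
    (hR : Decorrelates ε R.map (tensorPow ρ n))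
    (hsupp : HasLocalSupport (R.map (tensorPow ρ n)) (d ^ n))
    {ψ : Z × ((Fin n → A) × (Fin n → B)) → ℂ} (hψ : IsPurification ψ (tensorPow ρ n)) :
    n * (natEntropy (traceSnd ρ) + natEntropy (traceFst ρ) - natEntropy ρ
      - 3 * ε * log d - etaNat (3 * ε)) ≤ natEntropy (idTensor Z R.map (proj ψ)) := by
  have hσ := hρ.tensorPow n
  rcases Nat.eq_zero_or_pos n with rfl | hn
  · -- The bound below has no factor `n` in front of `η`, so `n = 0` is treated apart.
    simpa using natEntropy_nonneg (R.isState_idTensor hσ hψ)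
  obtain ⟨ωA, ωB, hA, hB, hnorm⟩ := hR
  have hε : 0 ≤ ε := (traceNorm_nonneg _).trans hnorm
  have hst := R.isState_map hσ
  have h1 := mutual_information_le hst hA hB (hasTraceBound_of_traceNorm_le
    (hst.1.isHermitian.sub (hA.kronecker hB).1.isHermitian) hnorm) hε hsupp
  have h2 := R.natEntropy_map_le hσ hψ
  have h3 := R.natEntropy_traceSnd_le_map hσ
  have h4 := R.natEntropy_traceFst_le_map hσ
  rw [traceSnd_tensorPow, natEntropy_kroneckerPow hρ.traceSnd] at h3
  rw [traceFst_tensorPow, natEntropy_kroneckerPow hρ.traceFst] at h4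
  rw [natEntropy_tensorPow hρ] at h2
  rw [log_pow] at h1
  -- Continuity costs `η (3 ε)` only once, so the factor `n` in front of it is slack.
  have h5 : etaNat (3 * ε) ≤ n * etaNat (3 * ε) :=
    le_mul_of_one_le_left (etaNat_nonneg (by positivity)) (by exact_mod_cast hn)
  linarith

lemma mutualInformation_eq {ρ : Matrix (A × B) (A × B) ℂ} (hρ : IsState ρ) :
    mutualInformation ρ =
      (natEntropy (traceSnd ρ) + natEntropy (traceFst ρ) - natEntropy ρ) / log 2 := by
  rw [mutualInformation, vonNeumannEntropy_eq hρ.traceSnd.1.isHermitian,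
    vonNeumannEntropy_eq hρ.traceFst.1.isHermitian, vonNeumannEntropy_eq hρ.1.isHermitian]
  ring

lemma shannonEntropy_eq {N : ℕ} (p : Fin N → ℝ) :
    shannonEntropy p = (∑ i, negMulLog (p i)) / log 2 := by
  rw [shannonEntropy, ← Finset.sum_neg_distrib, Finset.sum_div]
  refine Finset.sum_congr rfl fun i _ => ?_
  simp only [negMulLog, logb]
  ring

end QErasure

open QErasure in
theorem proposition1 {A : Type*} {B : Type*} [Fintype A] [DecidableEq A] [Fintype B]
    [DecidableEq B] (ρ : Matrix (A × B) (A × B) ℂ) (hρ : IsState ρ) (n : ℕ) (ε d : ℝ)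
    (R : LocalUnitaryEnsemble (Fin n → A) (Fin n → B))
    (hR : Decorrelates ε R.map (tensorPow ρ n))
    (hd : 0 ≤ d)
    (hsupp : HasLocalSupport (R.map (tensorPow ρ n)) (d ^ n)) :
    (∀ (Z : Type*) [Fintype Z] [DecidableEq Z] (ψ : Z × ((Fin n → A) × (Fin n → B)) → ℂ),
      IsPurification ψ (tensorPow ρ n) →
        (n : ℝ) * (mutualInformation ρ - 3 * ε * Real.logb 2 d - eta (3 * ε))
          ≤ entropyExchange R.map ψ) ∧
    (n : ℝ) * (mutualInformation ρ - 3 * ε * Real.logb 2 d - eta (3 * ε))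
      ≤ shannonEntropy R.p ∧
    (n : ℝ) * (mutualInformation ρ - 3 * ε * Real.logb 2 d - eta (3 * ε))
      ≤ Real.logb 2 (R.N : ℝ) := by
  have hσ := hρ.tensorPow n
  have hlog : 0 < Real.log 2 := Real.log_pos one_lt_two
  have hbits : (n : ℝ) * (mutualInformation ρ - 3 * ε * Real.logb 2 d - eta (3 * ε)) =
      n * (natEntropy (traceSnd ρ) + natEntropy (traceFst ρ) - natEntropy ρ
        - 3 * ε * Real.log d - etaNat (3 * ε)) / Real.log 2 := by
    rw [mutualInformation_eq hρ, eta_eq_etaNat_div, Real.logb]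
    ring
  rw [hbits]
  have hH : (n : ℝ) * (natEntropy (traceSnd ρ) + natEntropy (traceFst ρ) - natEntropy ρ
      - 3 * ε * Real.log d - etaNat (3 * ε)) ≤ ∑ i, Real.negMulLog (R.p i) := by
    obtain ⟨ψ, hψ⟩ := exists_isPurification hσ.1
    exact (le_natEntropy_idTensor hρ R hR hsupp hψ).trans (R.natEntropy_idTensor_le hσ hψ)
  refine ⟨fun Z _ _ ψ hψ => ?_, ?_, ?_⟩
  · rw [entropyExchange, vonNeumannEntropy_eq (R.isState_idTensor hσ hψ).1.isHermitian]
    exact div_le_div_of_nonneg_right (le_natEntropy_idTensor hρ R hR hsupp hψ) hlog.le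
  · rw [shannonEntropy_eq]
    exact div_le_div_of_nonneg_right hH hlog.le
  · refine div_le_div_of_nonneg_right (hH.trans ?_) hlog.le
    simpa [R.p_sum] using sum_negMulLog_le_card Finset.univ fun i _ => R.p_nonneg i
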